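/- Let $\mathbb I=[0,1]$, and for $\beta_1,\beta_2\in(0,1)$ let $F_{\beta_1,\beta_2}:\mathbb I\times\mathbb I\to\mathbb I\times\mathbb I$ be $$F_{\beta_1,\beta_2}(x,y)=\begin{cases}\bigl(2x,\ y+y(1-y)(y-\beta_1)\bigr), & 0\le x\le \tfrac12,\\ \bigl(2x-1,\ y-y(1-y)(y-\beta_2)\bigr), & \tfrac12<x\le 1.\end{cases}$$ Let $A_0=\mathbb I\times\{0\}$, $A_1=\mathbb I\times\{1\}$, and let $m$ be Lebesgue measure on $\mathbb I\times\mathbb I$. For $F:\mathbb I\times\mathbb I\to\mathbb I\times\mathbb I$ and a set $A\subset\mathbb I\times\mathbb I$, the basin $\mathcal B(A)$ is the set of points whose $\omega$-limit set (the set of limit points of the forward orbit) is contained in $A$. A compact set $A$ with $F(A)=A$ is a *Milnor attractor* if $m(\mathcal B(A))>0$ and there is no compact proper subset $A'\subsetneq A$ for which $\mathcal B(A')$ and $\mathcal B(A)$ coincide up to a set of $m$-measure zero. A Milnor attractor $A$ has a *locally riddled basin* if there is a neighbourhood $U$ of $A$ such that, for all $p\in A$ and all $\varepsilon>0$, $$m\Bigl(B_\varepsilon(p)\cap\bigl(\textstyle\bigcap_{n\ge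 0}F^{-n}(U)\bigr)^c\Bigr)>0 .$$ **Corollary 3.4.** The region $$\Gamma_S=\Bigl\{(\beta_1,\beta_2)\in(0,1)^2:\ 2-\tfrac1{\beta_1}<\beta_2<\tfrac1{1-\beta_1}-1\Bigr\}$$ is nonempty and open in $\mathbb R^2$, and for every $(\beta_1,\beta_2)\in\Gamma_S$ both $A_0$ and $A_1$ are Milnor attractors of $F_{\beta_1,\beta_2}$ and have locally riddled basins. -/

import Mathlib

noncomputable section

namespace RiddledSkew

open MeasureTheory Filter Set

/-! ### Attractors and locally riddled basins -/

section Attractors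

variable {M : Type*}

/-- The basin of attraction of `A`: the points whose `ω`-limit set is contained in `A`. -/
def basin [TopologicalSpace M] (F : M → M) (A : Set M) : Set M :=
  {p | omegaLimit atTop (fun (n : ℕ) (q : M) => F^[n] q) {p} ⊆ A}

/-- `A` is a Milnor attractor of `F`: it is compact and invariant (`F(A) = A`), its basin has
nonzero measure, and no compact proper subset of `A` has the same basin up to a null set. -/
structure IsMilnorAttractor [TopologicalSpace M] [MeasureSpace M] (F : M → M) (A : Set M) :
    Prop where
  isCompact : IsCompact A
  image_eq : F '' A = A
  basin_pos : 0 < volume (basin F A)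
  minimal : ¬ ∃ A' : Set M, A' ⊂ A ∧ IsCompact A' ∧ basin F A' =ᵐ[volume] basin F A

/-- `A` is a Milnor attractor with a locally riddled basin: for some neighbourhood `U` of `A`,
every ball centred at a point of `A` contains, in positive measure, points whose forward orbit
leaves `U`. (Since all radii `ε > 0` are allowed, the condition depends on the metric only through
its topology.) -/
structure HasLocallyRiddledBasin [PseudoMetricSpace M] [MeasureSpace M] (F : M → M)
    (A : Set M) : Prop where
  isMilnorAttractor : IsMilnorAttractor F A
  riddled : ∃ U : Set M, IsOpen U ∧ A ⊆ U ∧ ∀ p ∈ A, ∀ ε : ℝ, 0 < ε →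
    0 < volume (Metric.ball p ε ∩ (⋂ n : ℕ, F^[n] ⁻¹' U)ᶜ)

end Attractors

/-! ### The cubic-fibre skew product on the unit square -/

theorem base_left_mem {x : ℝ} (h0 : 0 ≤ x) (h : x ≤ 1 / 2) : 2 * x ∈ unitInterval :=
  ⟨by linarith, by linarith⟩

theorem base_right_mem {x : ℝ} (h1 : x ≤ 1) (h : ¬ x ≤ 1 / 2) : 2 * x - 1 ∈ unitInterval :=
  ⟨by linarith, by linarith⟩

/-- The base map `f x = 2x` on `[0, 1/2]`, `f x = 2x - 1` on `(1/2, 1]`. -/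
def base (x : unitInterval) : unitInterval :=
  if h : (x : ℝ) ≤ 1 / 2 then ⟨2 * (x : ℝ), base_left_mem x.2.1 h⟩
  else ⟨2 * (x : ℝ) - 1, base_right_mem x.2.2 h⟩

theorem fiber_bound (β y : unitInterval) :
    -1 ≤ (1 - (y : ℝ)) * (y - β) ∧ (y : ℝ) * (y - β) ≤ 1 ∧
      (1 - (y : ℝ)) * (y - β) ≤ 1 ∧ -1 ≤ (y : ℝ) * (y - β) := by
  obtain ⟨b, hb0, hb1⟩ := β
  obtain ⟨y, hy0, hy1⟩ := y
  dsimp only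
  refine ⟨?_, ?_, ?_, ?_⟩ <;> nlinarith [mul_nonneg hy0 hb0, mul_nonneg hy0 (sub_nonneg.2 hb1),
    mul_nonneg (sub_nonneg.2 hy1) hb0, mul_nonneg (sub_nonneg.2 hy1) (sub_nonneg.2 hb1),
    mul_nonneg hy0 (sub_nonneg.2 hy1)]

theorem fiberOne_mem (β y : unitInterval) :
    (y : ℝ) + y * (1 - y) * (y - β) ∈ unitInterval := by
  obtain ⟨h1, h2, -, -⟩ := fiber_bound β y
  constructor
  · nlinarith [mul_nonneg y.2.1 (sub_nonneg.2 h1)]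
  · nlinarith [mul_nonneg (sub_nonneg.2 y.2.2) (sub_nonneg.2 h2)]

theorem fiberTwo_mem (β y : unitInterval) :
    (y : ℝ) - y * (1 - y) * (y - β) ∈ unitInterval := by
  obtain ⟨-, -, h1, h2⟩ := fiber_bound β y
  constructor
  · nlinarith [mul_nonneg y.2.1 (sub_nonneg.2 h1)]
  · nlinarith [mul_nonneg (sub_nonneg.2 y.2.2) (sub_nonneg.2 h2)]

/-- The first fibre map `g₁ y = y + y (1 - y) (y - β)`. -/
def fiberOne (β y : unitInterval) : unitInterval :=
  ⟨(y : ℝ) + y * (1 - y) * (y - β), fiberOne_mem β y⟩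

/-- The second fibre map `g₂ y = y - y (1 - y) (y - β)`. -/
def fiberTwo (β y : unitInterval) : unitInterval :=
  ⟨(y : ℝ) - y * (1 - y) * (y - β), fiberTwo_mem β y⟩

/-- The skew product `F (x, y) = (f x, g₁ y)` for `x ≤ 1/2`, `(f x, g₂ y)` for `x > 1/2`. -/
def skew (β₁ β₂ : unitInterval) (p : unitInterval × unitInterval) :
    unitInterval × unitInterval :=
  (base p.1, if (p.1 : ℝ) ≤ 1 / 2 then fiberOne β₁ p.2 else fiberTwo β₂ p.2)

/-- `A₀ = [0,1] × {0}`. -/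
def attractorZero : Set (unitInterval × unitInterval) := univ ×ˢ {0}

/-- `A₁ = [0,1] × {1}`. -/
def attractorOne : Set (unitInterval × unitInterval) := univ ×ˢ {1}

/-- The parameter region `Γ_S`. -/
def gammaS : Set (ℝ × ℝ) :=
  {b | b.1 ∈ Ioo (0 : ℝ) 1 ∧ b.2 ∈ Ioo (0 : ℝ) 1 ∧
    2 - 1 / b.1 < b.2 ∧ b.2 < 1 / (1 - b.1) - 1}

end RiddledSkew

end

noncomputable section

namespace RiddledSkew

open MeasureTheory Filter Set
open scoped Topology ENNReal

/-! ### The base map -/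

/-! Close to `attractorZero` the skew product multiplies heights by about `1 - β₁` over the left
half of the base and `1 + β₂` over the right half. The halves are visited independently with
probability one half, so the normal Lyapunov exponent is half of `log ((1 - β₁) * (1 + β₂))`,
negative on `gammaS`. Hence over almost every `x` the products of multipliers, even slightly
enlarged, tend to zero (`ae_tendsto_branchProd`), and a whole fibre interval lies in the basin
(`basin_attractorZero_pos`). Minimality comes from ergodicity of doubling: almost every base orbit
returns to every interval (`ae_notMem_basin_of_ssubset`). Riddling comes from the base fixed point
`1`, where the normal multiplier `1 + β₂` exceeds one: near any point of the edge there is a box of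
points that come close enough to the fibre over `1` to be pushed away. The reflection `y ↦ 1 - y`
replaces each `β` by `1 - β` and carries everything over to `attractorOne`. -/

/-- The set of points visiting `s` infinitely often is exactly invariant, hence null or conull.
Poincaré recurrence puts almost all of `s` inside it, so it is not null. -/
theorem ae_frequently_mem_of_ergodic {α : Type*} [MeasurableSpace α] {μ : Measure α}
    [IsFiniteMeasure μ] {f : α → α} (hf : Ergodic f μ) {s : Set α} (hs : MeasurableSet s)
    (h0 : μ s ≠ 0) : ∀ᵐ x ∂μ, ∃ᶠ n in atTop, f^[n] x ∈ s := by
  set E : Set α := {x | ∃ᶠ n in atTop, f^[n] x ∈ s} with hE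
  have hEm : MeasurableSet E := by
    have : E = limsup (fun n => f^[n] ⁻¹' s) atTop := by
      ext x
      simp [hE, mem_limsup_iff_frequently_mem]
    rw [this]
    exact MeasurableSet.measurableSet_limsup fun n => (hf.measurable.iterate n) hs
  have hinv : f ⁻¹' E = E := by
    ext x
    simp only [hE, mem_preimage, mem_ofPred_eq, ← Function.iterate_succ_apply]
    exact (Filter.frequently_map (m := fun n => n + 1) (f := atTop)
      (P := fun n => f^[n] x ∈ s)).symm.trans (by rw [map_add_atTop_eq_nat])
  rcases hf.toPreErgodic.ae_mem_or_ae_notMem hEm hinv with h | h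
  · exact h
  · refine absurd ?_ h0
    have h2 := hf.toMeasurePreserving.conservative.ae_mem_imp_frequently_image_mem
      hs.nullMeasurableSet
    rw [measure_eq_zero_iff_ae_notMem]
    filter_upwards [h, h2] with x hx hx2 hxs
    exact hx (hx2 hxs)

theorem coe_base (x : unitInterval) :
    (base x : ℝ) = if (x : ℝ) ≤ 1 / 2 then 2 * (x : ℝ) else 2 * (x : ℝ) - 1 := by
  unfold base
  split_ifs <;> rfl

theorem measurable_base : Measurable base := by
  have h : Measurable fun x => (base x : ℝ) := by
    simp only [coe_base]
    refine Measurable.ite (measurableSet_le (by fun_prop) (by fun_prop)) ?_ ?_ <;> fun_prop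
  exact h.subtype_mk

theorem base_pos {x : unitInterval} (hx : 0 < (x : ℝ)) : 0 < (base x : ℝ) := by
  rw [coe_base]
  split_ifs <;> linarith

/-- The circle glues `0` to `1`; orbits that avoid `0` are recovered from their projection by
`ofCircle`. -/
theorem iterate_base_pos {x : unitInterval} (hx : 0 < (x : ℝ)) (n : ℕ) :
    0 < (base^[n] x : ℝ) := by
  induction n with
  | zero => exact hx
  | succ n ih => rw [Function.iterate_succ_apply']; exact base_pos ih

/-- The projection of the unit interval to the circle. -/
def toCircle (x : unitInterval) : UnitAddCircle := ((x : ℝ) : UnitAddCircle)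

theorem toCircle_base (x : unitInterval) : toCircle (base x) = 2 • toCircle x := by
  unfold toCircle
  rw [coe_base, two_nsmul, ← AddCircle.coe_add]
  split_ifs
  · rw [two_mul]
  · rw [AddCircle.coe_sub, AddCircle.coe_period, sub_zero, two_mul]

theorem toCircle_iterate_base (n : ℕ) (x : unitInterval) :
    toCircle (base^[n] x) = (fun z : UnitAddCircle => 2 • z)^[n] (toCircle x) := by
  induction n with
  | zero => rfl
  | succ n ih => rw [Function.iterate_succ_apply', Function.iterate_succ_apply', ← ih, toCircle_base]

theorem measurePreserving_toCircle : MeasurePreserving toCircle := by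
  have h := UnitAddCircle.measurePreserving_mk 0
  have h1 : (volume.restrict (Ioc (0 : ℝ) (0 + 1))) = volume.restrict unitInterval := by
    rw [zero_add]
    exact Measure.restrict_congr_set Ioc_ae_eq_Icc
  rw [h1] at h
  exact h.comp unitInterval.measurePreserving_coe

/-- The section of `toCircle` with values in `(0, 1]`. -/
def ofCircle (z : UnitAddCircle) : unitInterval :=
  ⟨AddCircle.measurableEquivIoc 1 0 z, Ioc_subset_Icc_self (by
    simpa using (AddCircle.measurableEquivIoc 1 0 z).2)⟩

theorem measurable_ofCircle : Measurable ofCircle :=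
  (measurable_subtype_coe.comp (AddCircle.measurableEquivIoc 1 0).measurable).subtype_mk

theorem ofCircle_toCircle {x : unitInterval} (hx : 0 < (x : ℝ)) : ofCircle (toCircle x) = x := by
  apply Subtype.ext
  change ((AddCircle.equivIoc 1 0 ((x : ℝ) : UnitAddCircle) : _) : ℝ) = x
  rw [AddCircle.equivIoc_coe_eq (by simpa using ⟨hx, x.2.2⟩)]

theorem ae_frequently_iterate_base_mem {J : Set unitInterval} (hJ : MeasurableSet J)
    (h0 : volume J ≠ 0) : ∀ᵐ x : unitInterval, ∃ᶠ n in atTop, base^[n] x ∈ J := by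
  have hpos : ∀ᵐ x : unitInterval, 0 < (x : ℝ) := by
    have : ∀ᵐ x : unitInterval, x ≠ 0 := by
      simp [ae_iff]
    filter_upwards [this] with x hx
    exact unitInterval.pos_iff_ne_zero.2 hx
  have hV : volume (ofCircle ⁻¹' J) ≠ 0 := by
    rw [← measurePreserving_toCircle.measure_preimage (measurable_ofCircle hJ).nullMeasurableSet]
    intro h
    apply h0
    rw [← h]
    apply measure_congr
    filter_upwards [hpos] with x hx
    apply propext
    change x ∈ J ↔ ofCircle (toCircle x) ∈ J
    rw [ofCircle_toCircle hx]
  have h := ae_frequently_mem_of_ergodic (AddCircle.ergodic_nsmul (T := 1) one_lt_two)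
    (measurable_ofCircle hJ) hV
  have h' := measurePreserving_toCircle.quasiMeasurePreserving.ae h
  filter_upwards [h', hpos] with x hx hx0
  refine hx.mono fun n hn => ?_
  rw [← toCircle_iterate_base, mem_preimage, ofCircle_toCircle (iterate_base_pos hx0 n)] at hn
  exact hn

theorem setLIntegral_comp_two_mul_add (ψ : ℝ → ℝ≥0∞) (c u v : ℝ) :
    ∫⁻ t in Ioc (2 * u + c) (2 * v + c), ψ t = 2 * ∫⁻ t in Ioc u v, ψ (2 * t + c) := by
  have himg : Ioc (2 * u + c) (2 * v + c) = (fun t : ℝ => 2 * t + c) '' Ioc u v := by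
    rw [show (fun t : ℝ => 2 * t + c) = (fun t => t + c) ∘ (fun t => 2 * t) from rfl, image_comp,
      image_mul_left_Ioc two_pos, image_add_const_Ioc]
  rw [himg, lintegral_image_eq_lintegral_abs_deriv_mul measurableSet_Ioc (f' := fun _ => 2)]
  · rw [lintegral_const_mul']
    · simp
    · simp
  · intro x _
    simpa using (((hasDerivAt_id x).const_mul 2).add_const c).hasDerivWithinAt
  · intro x _ y _ h
    simpa using h

/-- Each branch maps its half affinely onto the whole interval, so the choice of branch is
independent of the next point. -/
theorem lintegral_mul_comp_base (a b : ℝ≥0∞) {φ : unitInterval → ℝ≥0∞} (hφ : Measurable φ) :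
    ∫⁻ x : unitInterval, (if (x : ℝ) ≤ 1 / 2 then a else b) * φ (base x) =
      (a + b) / 2 * ∫⁻ x, φ x := by
  set ψ : ℝ → ℝ≥0∞ := fun t => φ (projIcc 0 1 zero_le_one t) with hψ
  have hψm : Measurable ψ := hφ.comp continuous_projIcc.measurable
  have hI : ∀ G : ℝ → ℝ≥0∞, Measurable G →
      ∫⁻ x : unitInterval, G x = ∫⁻ t in Ioc (0 : ℝ) 1, G t := by
    intro G hG
    rw [unitInterval.measurePreserving_coe.lintegral_comp hG]
    exact setLIntegral_congr Ioc_ae_eq_Icc.symm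
  have hval : ∀ x : unitInterval, ψ x = φ x := fun x => by simp [hψ]
  have hR : ∫⁻ x, φ x = ∫⁻ t in Ioc (0 : ℝ) 1, ψ t := by
    rw [← hI ψ hψm]; simp only [hval]
  have hL : ∫⁻ x : unitInterval, (if (x : ℝ) ≤ 1 / 2 then a else b) * φ (base x) =
      ∫⁻ t in Ioc (0 : ℝ) 1, if t ≤ 1 / 2 then a * ψ (2 * t + 0) else b * ψ (2 * t + -1) := by
    rw [← hI]
    · refine lintegral_congr fun x => ?_
      have := hval (base x)
      rw [coe_base] at this
      rw [← this]
      split_ifs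
      · simp
      · rw [sub_eq_add_neg]
    · refine Measurable.ite measurableSet_Iic ?_ ?_ <;> fun_prop
  have h1 := setLIntegral_comp_two_mul_add ψ 0 0 (1 / 2)
  have h2 := setLIntegral_comp_two_mul_add ψ (-1) (1 / 2) 1
  norm_num only at h1 h2
  rw [hL, hR, ← Ioc_union_Ioc_eq_Ioc (show (0 : ℝ) ≤ 1 / 2 by norm_num) (by norm_num),
    lintegral_union measurableSet_Ioc (by simp),
    Ioc_union_Ioc_eq_Ioc (show (0 : ℝ) ≤ 1 / 2 by norm_num) (by norm_num),
    setLIntegral_congr_fun (g := fun t => a * ψ (2 * t + 0)) measurableSet_Ioc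
      (fun t ht => if_pos ht.2),
    setLIntegral_congr_fun (g := fun t => b * ψ (2 * t + -1)) measurableSet_Ioc
      (fun t ht => if_neg (not_le.2 ht.1)),
    lintegral_const_mul _ (by fun_prop), lintegral_const_mul _ (by fun_prop)]
  rw [(ENNReal.mul_right_inj two_ne_zero ENNReal.ofNat_ne_top).1 (h2.symm.trans h1), h1,
    ← mul_assoc, ENNReal.div_mul_cancel two_ne_zero ENNReal.ofNat_ne_top, add_mul]

/-! ### Products of multipliers along the base dynamics -/

/-- The sum equals `2` at `s = 0` and has derivative `log (a * b) < 0` there. -/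
theorem exists_rpow_add_rpow_lt_two {a b : ℝ} (ha : 0 < a) (hb : 0 < b) (hab : a * b < 1) :
    ∃ s : ℝ, 0 < s ∧ a ^ s + b ^ s < 2 := by
  have hd : HasDerivAt (fun s : ℝ => a ^ s + b ^ s) (Real.log (a * b)) 0 := by
    have h1 := (hasDerivAt_id (0 : ℝ)).const_rpow ha
    have h2 := (hasDerivAt_id (0 : ℝ)).const_rpow hb
    convert! h1.add h2 using 1
    simp [Real.log_mul ha.ne' hb.ne']
  have hlog : Real.log (a * b) < 0 := Real.log_neg (mul_pos ha hb) hab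
  have hev := (hd.tendsto_slope_zero_right.eventually (gt_mem_nhds hlog)).and self_mem_nhdsWithin
  obtain ⟨s, hs, hs0⟩ := hev.exists
  refine ⟨s, hs0, ?_⟩
  have hs0 : 0 < s := hs0
  simp only [zero_add, Real.rpow_zero, smul_eq_mul] at hs
  have := (mul_neg_iff.1 hs).resolve_right fun h => absurd h.1 (not_lt.2 (inv_pos.2 hs0).le)
  linarith [this.2]

/-- The product of the multipliers `a` (left branch) and `b` (right branch) along the first `n`
points of the orbit of `x` under the base map. -/
def branchProd {R : Type*} [CommMonoid R] (a b : R) (n : ℕ) (x : unitInterval) : R :=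
  ∏ i ∈ Finset.range n, if (base^[i] x : ℝ) ≤ 1 / 2 then a else b

theorem branchProd_succ {R : Type*} [CommMonoid R] (a b : R) (n : ℕ) (x : unitInterval) :
    branchProd a b (n + 1) x =
      branchProd a b n x * if (base^[n] x : ℝ) ≤ 1 / 2 then a else b :=
  Finset.prod_range_succ _ _

theorem branchProd_succ' {R : Type*} [CommMonoid R] (a b : R) (n : ℕ) (x : unitInterval) :
    branchProd a b (n + 1) x = (if (x : ℝ) ≤ 1 / 2 then a else b) * branchProd a b n (base x) := by
  rw [branchProd, Finset.prod_range_succ', mul_comm]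
  rfl

theorem measurable_branchProd (a b : ℝ≥0∞) (n : ℕ) : Measurable (branchProd a b n) := by
  refine Finset.measurable_fun_prod _ fun i _ => ?_
  exact Measurable.ite (measurableSet_le ((measurable_base.iterate i).subtype_val)
    measurable_const) measurable_const measurable_const

theorem lintegral_branchProd (a b : ℝ≥0∞) (n : ℕ) :
    ∫⁻ x, branchProd a b n x = ((a + b) / 2) ^ n := by
  induction n with
  | zero => simp [branchProd]
  | succ n ih =>
    simp only [branchProd_succ']
    rw [lintegral_mul_comp_base _ _ (measurable_branchProd a b n), ih, pow_succ']

theorem ofReal_branchProd_rpow {a b : ℝ} (ha : 0 ≤ a) (hb : 0 ≤ b) (s : ℝ) (n : ℕ)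
    (x : unitInterval) :
    branchProd (ENNReal.ofReal (a ^ s)) (ENNReal.ofReal (b ^ s)) n x =
      ENNReal.ofReal (branchProd a b n x ^ s) := by
  unfold branchProd
  rw [← Real.finsetProd_rpow _ _ (fun i _ => by split_ifs <;> assumption),
    ENNReal.ofReal_prod_of_nonneg (fun i _ => by split_ifs <;> positivity)]
  refine Finset.prod_congr rfl fun i _ => ?_
  split_ifs <;> rfl

theorem branchProd_nonneg {a b : ℝ} (ha : 0 ≤ a) (hb : 0 ≤ b) (n : ℕ) (x : unitInterval) :
    0 ≤ branchProd a b n x :=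
  Finset.prod_nonneg fun i _ => by split_ifs <;> assumption

/-- For a suitable small `s`, the `s`-th powers of the products have integrals forming a convergent
geometric series. Their sum is therefore finite almost everywhere, so its terms tend to zero. -/
theorem ae_tendsto_branchProd {a b : ℝ} (ha : 0 < a) (hb : 0 < b) (hab : a * b < 1) :
    ∀ᵐ x : unitInterval, Tendsto (fun n => branchProd a b n x) atTop (𝓝 0) := by
  obtain ⟨s, hs, hlt⟩ := exists_rpow_add_rpow_lt_two ha hb hab
  set A := ENNReal.ofReal (a ^ s)
  set B := ENNReal.ofReal (b ^ s)
  have hρ : (A + B) / 2 < 1 := by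
    rw [ENNReal.div_lt_iff (by simp) (by simp), one_mul,
      ← ENNReal.ofReal_add (by positivity) (by positivity)]
    exact (ENNReal.ofReal_lt_ofReal_iff two_pos).2 hlt |>.trans_eq (by simp)
  have hint : ∫⁻ x, ∑' n, branchProd A B n x ≠ ∞ := by
    rw [lintegral_tsum fun n => (measurable_branchProd A B n).aemeasurable]
    simp only [lintegral_branchProd, ENNReal.tsum_geometric]
    exact ENNReal.inv_ne_top.2 (tsub_pos_of_lt hρ).ne'
  have hfin := ae_lt_top (Measurable.tsum (measurable_branchProd A B)) hint
  filter_upwards [hfin] with x hx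
  have h0 := ENNReal.tendsto_atTop_zero_of_tsum_ne_top hx.ne
  simp only [A, B, ofReal_branchProd_rpow ha.le hb.le] at h0
  have h1 := (ENNReal.tendsto_toReal ENNReal.zero_ne_top).comp h0
  have h2 : Tendsto (fun n => branchProd a b n x ^ s) atTop (𝓝 0) := by
    refine h1.congr fun n => ?_
    exact ENNReal.toReal_ofReal (Real.rpow_nonneg (branchProd_nonneg ha.le hb.le n x) s)
  have h3 := h2.rpow_const (p := s⁻¹) (Or.inr (inv_pos.2 hs).le)
  rw [Real.zero_rpow (inv_pos.2 hs).ne'] at h3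
  exact h3.congr fun n => Real.rpow_rpow_inv (branchProd_nonneg ha.le hb.le n x) hs.ne'

/-! ### The skew product -/

theorem iterate_skew_fst (β₁ β₂ : unitInterval) (n : ℕ) (p : unitInterval × unitInterval) :
    ((skew β₁ β₂)^[n] p).1 = base^[n] p.1 := by
  induction n with
  | zero => rfl
  | succ n ih => rw [Function.iterate_succ_apply', Function.iterate_succ_apply', ← ih]; rfl

theorem coe_skew_snd (β₁ β₂ : unitInterval) (p : unitInterval × unitInterval) :
    ((skew β₁ β₂ p).2 : ℝ) = if (p.1 : ℝ) ≤ 1 / 2 then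
      (p.2 : ℝ) + p.2 * (1 - p.2) * (p.2 - β₁) else (p.2 : ℝ) - p.2 * (1 - p.2) * (p.2 - β₂) := by
  unfold skew
  dsimp only
  split_ifs <;> rfl

theorem coe_skew_snd_le {β₁ β₂ : unitInterval} {δ : ℝ} (p : unitInterval × unitInterval)
    (hδ : (p.2 : ℝ) ≤ δ) : ((skew β₁ β₂ p).2 : ℝ) ≤
      p.2 * if (p.1 : ℝ) ≤ 1 / 2 then 1 - β₁ + 2 * δ else 1 + β₂ := by
  rw [coe_skew_snd]
  obtain ⟨x, y, hy0, hy1⟩ := p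
  obtain ⟨b, hb0, hb1⟩ := β₁
  obtain ⟨c, hc0, hc1⟩ := β₂
  dsimp only at *
  have hyy := mul_nonneg hy0 hy0
  split_ifs
  · have : (1 - y) * (y - b) ≤ - b + 2 * δ := by nlinarith
    nlinarith
  · have : -((1 - y) * (y - c)) ≤ c := by nlinarith
    nlinarith

/-- A bootstrap: the bound at time `n` keeps the height below `δ`, which is what the one-step
estimate needs at time `n + 1`. -/
theorem iterate_skew_snd_le {β₁ β₂ : unitInterval} {δ C : ℝ} (hδ : 0 ≤ δ)
    (p : unitInterval × unitInterval)
    (hC : ∀ n, branchProd (1 - (β₁ : ℝ) + 2 * δ) (1 + (β₂ : ℝ)) n p.1 ≤ C)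
    (hp : C * p.2 ≤ δ) (n : ℕ) :
    (((skew β₁ β₂)^[n] p).2 : ℝ) ≤
      branchProd (1 - (β₁ : ℝ) + 2 * δ) (1 + (β₂ : ℝ)) n p.1 * p.2 := by
  induction n with
  | zero => simp [branchProd]
  | succ n ih =>
    have hle : (((skew β₁ β₂)^[n] p).2 : ℝ) ≤ δ :=
      ih.trans ((mul_le_mul_of_nonneg_right (hC n) p.2.2.1).trans hp)
    rw [Function.iterate_succ_apply', branchProd_succ]
    refine (coe_skew_snd_le _ hle).trans ?_
    rw [iterate_skew_fst, mul_right_comm]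
    refine mul_le_mul_of_nonneg_right ih ?_
    have := β₁.2.2
    have := β₂.2.1
    split_ifs <;> linarith

theorem mem_basin_attractorZero {F : unitInterval × unitInterval → unitInterval × unitInterval}
    {p : unitInterval × unitInterval}
    (h : Tendsto (fun n => ((F^[n] p).2 : ℝ)) atTop (𝓝 0)) : p ∈ basin F attractorZero := by
  intro z hz
  rw [mem_omegaLimit_singleton_iff_mapClusterPt] at hz
  have h1 : MapClusterPt ((z.2 : ℝ)) atTop fun n => ((F^[n] p).2 : ℝ) :=
    hz.continuousAt_comp (f := fun q : unitInterval × unitInterval => (q.2 : ℝ))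
      (Continuous.continuousAt (by fun_prop))
  refine ⟨trivial, Subtype.ext ?_⟩
  exact eq_of_nhds_neBot (h1.clusterPt.mono h)

theorem basin_attractorZero_pos {β₁ β₂ : unitInterval}
    (h : (1 - (β₁ : ℝ)) * (1 + β₂) < 1) : 0 < volume (basin (skew β₁ β₂) attractorZero) := by
  have hβ₁ := β₁.2.2
  have hβ₂ := β₂.2.1
  obtain ⟨δ, hδ, hlt⟩ : ∃ δ : ℝ, 0 < δ ∧ (1 - (β₁ : ℝ) + 2 * δ) * (1 + β₂) < 1 := by
    have hc : Tendsto (fun δ : ℝ => (1 - (β₁ : ℝ) + 2 * δ) * (1 + β₂)) (𝓝[>] 0)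
        (𝓝 ((1 - (β₁ : ℝ) + 2 * 0) * (1 + β₂))) :=
      (Continuous.tendsto (by fun_prop) _).mono_left nhdsWithin_le_nhds
    rw [mul_zero, add_zero] at hc
    obtain ⟨δ, h1, h2⟩ := ((hc.eventually (gt_mem_nhds h)).and self_mem_nhdsWithin).exists
    exact ⟨δ, h2, h1⟩
  have hae := ae_tendsto_branchProd (by linarith) (by linarith) hlt
  rw [pos_iff_ne_zero]
  -- If the basin were null, almost every fibre would meet it in a null set; a fibre with bounded
  -- products contains the interval up to `min (δ / C) 1`.
  intro h0
  have hnot := Measure.ae_ae_of_ae_prod (measure_eq_zero_iff_ae_notMem.1 h0)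
  obtain ⟨x, hx, hx'⟩ := (hae.and hnot).exists
  obtain ⟨C, hC⟩ := hx.bddAbove_range
  have hC' : ∀ n, branchProd (1 - (β₁ : ℝ) + 2 * δ) (1 + (β₂ : ℝ)) n x ≤ C :=
    fun n => hC (mem_range_self n)
  have hC1 : 1 ≤ C := by simpa [branchProd] using hC' 0
  have hpos : 0 < min (δ / C) 1 := lt_min (by positivity) one_pos
  set y₀ : unitInterval := ⟨min (δ / C) 1, hpos.le, min_le_right _ _⟩
  have hvol : volume (Iic y₀) ≠ 0 := by
    rw [unitInterval.volume_Iic]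
    simpa [y₀, ENNReal.ofReal_eq_zero] using hpos
  refine hvol (measure_eq_zero_iff_ae_notMem.2 ?_)
  filter_upwards [hx'] with y hy hyy
  refine hy (mem_basin_attractorZero ?_)
  have hyδ : C * (y : ℝ) ≤ δ := by
    rw [mul_comm, ← le_div_iff₀ (by linarith)]
    exact (show (y : ℝ) ≤ min (δ / C) 1 from hyy).trans (min_le_left _ _)
  refine squeeze_zero (fun n => ((skew β₁ β₂)^[n] (x, y)).2.2.1)
    (iterate_skew_snd_le hδ.le (x, y) hC' hyδ) ?_
  simpa using hx.mul_const (y : ℝ)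

theorem image_skew_attractorZero (β₁ β₂ : unitInterval) :
    skew β₁ β₂ '' attractorZero = attractorZero := by
  have hsnd : ∀ x, (skew β₁ β₂ (x, 0)).2 = 0 := fun x => by
    apply Subtype.ext
    rw [coe_skew_snd]
    simp
  apply Subset.antisymm
  · rintro _ ⟨⟨x, y⟩, ⟨-, rfl : y = 0⟩, rfl⟩
    exact ⟨trivial, hsnd x⟩
  · rintro ⟨x, y⟩ ⟨-, rfl : y = 0⟩
    have hx : (x : ℝ) / 2 ≤ 1 / 2 := by linarith [x.2.2]
    refine ⟨(⟨x / 2, by linarith [x.2.1], by linarith [x.2.2]⟩, 0), ⟨trivial, rfl⟩, ?_⟩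
    refine Prod.ext (Subtype.ext ?_) (hsnd _)
    change (base _ : ℝ) = _
    rw [coe_base, if_pos hx]
    ring

/-- Some interval `Icc b c` of the edge misses `A'`. Almost every orbit returns infinitely often to
the compact strip above it, so it has a limit point there, outside `A'`. -/
theorem ae_notMem_basin_of_ssubset {β₁ β₂ : unitInterval}
    {A' : Set (unitInterval × unitInterval)} (hA' : A' ⊂ attractorZero) (hc : IsCompact A') :
    ∀ᵐ p, p ∉ basin (skew β₁ β₂) A' := by
  obtain ⟨hsub, hne⟩ := hA'
  obtain ⟨⟨x₀, y₀⟩, ⟨-, hy₀ : y₀ = 0⟩, hnot⟩ := not_subset.1 hne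
  subst hy₀
  set V : Set unitInterval := (fun x => (x, (0 : unitInterval))) ⁻¹' A'ᶜ with hV
  have hVo : IsOpen V := hc.isClosed.isOpen_compl.preimage (by fun_prop)
  obtain ⟨b, c, -, hK, hKV⟩ := exists_Icc_mem_subset_of_mem_nhds (hVo.mem_nhds hnot)
  have hbc : b < c := by
    by_contra hcb
    refine infinite_of_mem_nhds x₀ hK (Set.Subsingleton.finite ?_)
    exact subsingleton_Icc_of_ge (not_lt.1 hcb)
  have hK0 : volume (Icc b c) ≠ 0 := by
    rw [unitInterval.volume_Icc]
    exact (ENNReal.ofReal_pos.2 (sub_pos.2 hbc)).ne'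
  have hae := ae_frequently_iterate_base_mem measurableSet_Icc hK0
  have hae2 := (Measure.quasiMeasurePreserving_fst (μ := (volume : Measure unitInterval))
    (ν := (volume : Measure unitInterval))).ae hae
  filter_upwards [hae2] with p hp hpb
  have hf : ∃ᶠ n in atTop, (skew β₁ β₂)^[n] p ∈ Icc b c ×ˢ (univ : Set unitInterval) := by
    refine hp.mono fun n hn => ⟨?_, trivial⟩
    rw [iterate_skew_fst]
    exact hn
  obtain ⟨z, hzK, hz⟩ := (isCompact_Icc.prod isCompact_univ).exists_mapClusterPt_of_frequently hf
  have hzA : z ∈ A' := hpb ((mem_omegaLimit_singleton_iff_mapClusterPt _ _ _ _).2 hz)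
  have hz0 : z.2 = 0 := (hsub hzA).2
  have := hKV hzK.1
  apply this
  change (z.1, (0 : unitInterval)) ∈ A'
  rwa [← hz0]

theorem isMilnorAttractor_attractorZero {β₁ β₂ : unitInterval}
    (h : (1 - (β₁ : ℝ)) * (1 + β₂) < 1) : IsMilnorAttractor (skew β₁ β₂) attractorZero where
  isCompact := isCompact_univ.prod isCompact_singleton
  image_eq := image_skew_attractorZero β₁ β₂
  basin_pos := basin_attractorZero_pos h
  minimal := by
    rintro ⟨A', hA', hc, hae⟩
    refine (basin_attractorZero_pos h).ne' ?_
    rw [← measure_congr hae]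
    exact measure_eq_zero_iff_ae_notMem.2 (ae_notMem_basin_of_ssubset hA' hc)

/-! ### Riddling near the bottom edge -/

theorem exists_int_iterate_base_eq (n : ℕ) (x : unitInterval) :
    ∃ m : ℤ, (base^[n] x : ℝ) = 2 ^ n * x - m := by
  induction n with
  | zero => exact ⟨0, by simp⟩
  | succ n ih =>
    obtain ⟨m, hm⟩ := ih
    rw [Function.iterate_succ_apply', coe_base, hm]
    split_ifs
    · exact ⟨2 * m, by push_cast; ring⟩
    · exact ⟨2 * m + 1, by push_cast; ring⟩

/-- Positive points have iterates in `(0, 1]`, since `base` sends `1 / 2` to `1`; this fixes the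
integer part and forces intervals open on the left. -/
theorem iterate_base_eq_of_mem_Ioc {n k : ℕ} {x : unitInterval}
    (h : 2 ^ n * (x : ℝ) ∈ Ioc (k : ℝ) (k + 1)) : (base^[n] x : ℝ) = 2 ^ n * x - k := by
  have hx : 0 < (x : ℝ) := by
    have : (0 : ℝ) < 2 ^ n * x := lt_of_le_of_lt k.cast_nonneg h.1
    exact pos_of_mul_pos_right this (by positivity)
  obtain ⟨m, hm⟩ := exists_int_iterate_base_eq n x
  have h0 := iterate_base_pos hx n
  have h1 := (base^[n] x).2.2
  obtain ⟨h2, h3⟩ := h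
  have h4 : (m : ℝ) < ((k + 1 : ℤ) : ℝ) := by push_cast; linarith
  have h5 : ((k - 1 : ℤ) : ℝ) < m := by push_cast; linarith
  have h6 : m = k := by have := Int.cast_lt.1 h4; have := Int.cast_lt.1 h5; omega
  rw [hm, h6, Int.cast_natCast]

/-- On the right branch the distance to the fixed point `1` doubles at each step. -/
theorem half_lt_iterate_base (N : ℕ) {x : unitInterval} (hx : 1 - (1 / 2) ^ N < (x : ℝ))
    {j : ℕ} (hj : j < N) : (1 / 2 : ℝ) < base^[j] x := by
  induction N generalizing x j with
  | zero => omega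
  | succ N ih =>
    have hN : ((1 / 2 : ℝ)) ^ N ≤ 1 := pow_le_one₀ (by norm_num) (by norm_num)
    rw [pow_succ] at hx
    have hx2 : (1 / 2 : ℝ) < x := by linarith
    cases j with
    | zero => exact hx2
    | succ j =>
      rw [Function.iterate_succ_apply]
      refine ih ?_ (by omega)
      rw [coe_base, if_neg (not_le.2 hx2)]
      linarith

/-- Worst-case contraction; `3 / 4` comes from `(1 - y) * (y - β₂) ≤ 1 / 4`. -/
theorem mul_snd_le_coe_skew_snd (β₁ β₂ : unitInterval) (p : unitInterval × unitInterval) :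
    min (1 - (β₁ : ℝ)) (3 / 4) * p.2 ≤ (skew β₁ β₂ p).2 := by
  rw [coe_skew_snd]
  obtain ⟨x, y, hy0, hy1⟩ := p
  obtain ⟨b, hb0, hb1⟩ := β₁
  obtain ⟨c, hc0, hc1⟩ := β₂
  dsimp only at *
  split_ifs
  · have h1 : - b ≤ (1 - y) * (y - b) := by nlinarith
    have h2 := mul_le_mul_of_nonneg_right (min_le_left (1 - b) (3 / 4)) hy0
    nlinarith
  · have h1 : (1 - y) * (y - c) ≤ 1 / 4 := by nlinarith [sq_nonneg (y - 1 / 2)]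
    have h2 := mul_le_mul_of_nonneg_right (min_le_right (1 - b) (3 / 4)) hy0
    nlinarith

theorem pow_mul_snd_le_coe_iterate_skew_snd (β₁ β₂ : unitInterval)
    (p : unitInterval × unitInterval) (n : ℕ) :
    min (1 - (β₁ : ℝ)) (3 / 4) ^ n * p.2 ≤ ((skew β₁ β₂)^[n] p).2 := by
  induction n with
  | zero => simp
  | succ n ih =>
    rw [Function.iterate_succ_apply', pow_succ', mul_assoc]
    refine le_trans ?_ (mul_snd_le_coe_skew_snd β₁ β₂ _)
    exact mul_le_mul_of_nonneg_left ih (le_min (sub_nonneg.2 β₁.2.2) (by norm_num))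

/-- Here `1 - y ≥ 1 / 2` and `β₂ - y ≥ β₂ / 2`, whence the rate. -/
theorem one_add_mul_snd_le_coe_skew_snd {β₁ β₂ : unitInterval} {p : unitInterval × unitInterval}
    (hx : 1 / 2 < (p.1 : ℝ)) (hy : (p.2 : ℝ) ≤ β₂ / 2) :
    (1 + (β₂ : ℝ) / 4) * p.2 ≤ (skew β₁ β₂ p).2 := by
  rw [coe_skew_snd, if_neg (not_le.2 hx)]
  obtain ⟨x, y, hy0, hy1⟩ := p
  obtain ⟨c, hc0, hc1⟩ := β₂
  dsimp only at *
  have : c / 4 ≤ (1 - y) * (c - y) := by nlinarith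
  nlinarith

theorem pow_mul_snd_le_of_forall_le {β₁ β₂ : unitInterval} {p : unitInterval × unitInterval}
    {N : ℕ} (hx : 1 - (1 / 2) ^ N < (p.1 : ℝ))
    (hy : ∀ j, (((skew β₁ β₂)^[j] p).2 : ℝ) ≤ β₂ / 2) {j : ℕ} (hj : j ≤ N) :
    (1 + (β₂ : ℝ) / 4) ^ j * p.2 ≤ ((skew β₁ β₂)^[j] p).2 := by
  induction j with
  | zero => simp
  | succ j ih =>
    rw [Function.iterate_succ_apply', pow_succ', mul_assoc]
    refine le_trans ?_ (one_add_mul_snd_le_coe_skew_snd ?_ (hy j))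
    · exact mul_le_mul_of_nonneg_left (ih (by omega)) (by linarith [β₂.2.1])
    · rw [iterate_skew_fst]
      exact half_lt_iterate_base N hx (by omega)

theorem exists_nat_mul_two_pow_mem_Icc (n : ℕ) (x : unitInterval) :
    ∃ k : ℕ, k + 1 ≤ 2 ^ n ∧ 2 ^ n * (x : ℝ) ∈ Icc (k : ℝ) (k + 1) := by
  have hx : 0 ≤ 2 ^ n * (x : ℝ) := mul_nonneg (by positivity) x.2.1
  rcases hx.eq_or_lt with h | h
  · exact ⟨0, Nat.one_le_two_pow, by rw [← h]; simp⟩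
  -- The ceiling minus one, rather than the floor, keeps `k + 1 ≤ 2 ^ n` when `x = 1`.
  · obtain ⟨k, hk⟩ := Nat.exists_eq_succ_of_ne_zero (Nat.ceil_pos.2 h).ne'
    have h1 := Nat.le_ceil (2 ^ n * (x : ℝ))
    have h2 := Nat.ceil_lt_add_one hx
    have h3 : ⌈2 ^ n * (x : ℝ)⌉₊ ≤ 2 ^ n := by
      rw [Nat.ceil_le]
      push_cast
      exact mul_le_of_le_one_right (by positivity) x.2.2
    rw [hk] at h1 h2 h3
    push_cast at h1 h2
    exact ⟨k, h3, by linarith, h1⟩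

theorem hasLocallyRiddledBasin_attractorZero {β₁ β₂ : unitInterval} (hβ₁ : (β₁ : ℝ) < 1)
    (hβ₂ : 0 < (β₂ : ℝ)) (h : (1 - (β₁ : ℝ)) * (1 + β₂) < 1) :
    HasLocallyRiddledBasin (skew β₁ β₂) attractorZero where
  isMilnorAttractor := isMilnorAttractor_attractorZero h
  riddled := by
    -- Below height `β₂ / 2` the right branch expands heights by at least `1 + β₂ / 4`.
    refine ⟨{p | (p.2 : ℝ) < β₂ / 2}, isOpen_lt (by fun_prop) continuous_const, ?_, ?_⟩
    · rintro p ⟨-, hp : p.2 = 0⟩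
      change ((p.2 : unitInterval) : ℝ) < β₂ / 2
      rw [hp]
      simpa using hβ₂
    rintro ⟨x₀, y₀⟩ ⟨-, hy₀ : y₀ = 0⟩ ε hε
    subst hy₀
    obtain ⟨n, hn⟩ := exists_pow_lt_of_lt_one hε (show (1 / 2 : ℝ) < 1 by norm_num)
    obtain ⟨k, hk, hkx⟩ := exists_nat_mul_two_pow_mem_Icc n x₀
    set c := min (1 - (β₁ : ℝ)) (3 / 4) with hc
    have hc0 : 0 < c := lt_min (by linarith) (by norm_num)
    set r := min ε 1 with hr
    have hr0 : 0 < r := lt_min hε one_pos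
    have hr1 : r ≤ 1 := min_le_right _ _
    -- After `n` steps a height above `r / 2` is still at least `c ^ n * (r / 2)`; `N` further
    -- expansions must lift this beyond `β₂ / 2`.
    obtain ⟨N, hN⟩ := pow_unbounded_of_one_lt ((β₂ : ℝ) / 2 / (c ^ n * (r / 2)))
      (show 1 < 1 + (β₂ : ℝ) / 4 by linarith)
    rw [div_lt_iff₀ (by positivity)] at hN
    have hN0 : (0 : ℝ) < (1 / 2) ^ N := by positivity
    have hN1 : ((1 / 2 : ℝ)) ^ N ≤ 1 := pow_le_one₀ (by norm_num) (by norm_num)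
    have h2n : (0 : ℝ) < 2 ^ n := by positivity
    have hk' : (k : ℝ) + 1 ≤ 2 ^ n := by exact_mod_cast hk
    have hk0 : (0 : ℝ) ≤ k := k.cast_nonneg
    have hu0 : 0 ≤ ((k : ℝ) + 1 - (1 / 2) ^ N) / 2 ^ n := div_nonneg (by linarith) h2n.le
    have hu1 : ((k : ℝ) + 1 - (1 / 2) ^ N) / 2 ^ n ≤ 1 := (div_le_one h2n).2 (by linarith)
    have hv1 : ((k : ℝ) + 1) / 2 ^ n ≤ 1 := (div_le_one h2n).2 hk'
    -- The box lies over the last `2⁻ᴺ` fraction of a dyadic interval of length `2⁻ⁿ < ε` containing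
    -- `x₀`, so `n` base steps carry it within `2⁻ᴺ` of `1`.
    let u : unitInterval := ⟨((k : ℝ) + 1 - (1 / 2) ^ N) / 2 ^ n, hu0, hu1⟩
    let v : unitInterval := ⟨((k : ℝ) + 1) / 2 ^ n, by positivity, hv1⟩
    let s : unitInterval := ⟨r / 2, by positivity, by linarith⟩
    let t : unitInterval := ⟨r, hr0.le, hr1⟩
    have hpos : 0 < volume (Ioo u v ×ˢ Ioo s t) := by
      rw [Measure.volume_eq_prod, Measure.prod_prod, unitInterval.volume_Ioo,
        unitInterval.volume_Ioo]
      refine ENNReal.mul_pos (ENNReal.ofReal_pos.2 (sub_pos.2 ?_)).ne'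
        (ENNReal.ofReal_pos.2 (sub_pos.2 ?_)).ne'
      · exact div_lt_div_of_pos_right (by linarith) h2n
      · exact half_lt_self hr0
    refine hpos.trans_le (measure_mono ?_)
    rintro ⟨x, y⟩ ⟨⟨hux, hxv⟩, ⟨hsy, hyt⟩⟩
    replace hux : (k : ℝ) + 1 - (1 / 2) ^ N < 2 ^ n * x := (div_lt_iff₀' h2n).1 hux
    replace hxv : 2 ^ n * (x : ℝ) < k + 1 := (lt_div_iff₀' h2n).1 hxv
    replace hsy : r / 2 < (y : ℝ) := hsy
    replace hyt : (y : ℝ) < r := hyt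
    constructor
    · rw [Metric.mem_ball, Prod.dist_eq, max_lt_iff]
      constructor
      · refine lt_of_le_of_lt ?_ hn
        change |(x : ℝ) - x₀| ≤ _
        rw [one_div_pow, le_div_iff₀' h2n, ← abs_of_pos h2n, ← abs_mul, abs_le,
          mul_sub]
        constructor <;> linarith [hkx.1, hkx.2]
      · change |(y : ℝ) - 0| < _
        rw [sub_zero, abs_of_nonneg y.2.1]
        exact hyt.trans_le (min_le_left _ _)
    · intro hmem
      have hstay : ∀ j, (((skew β₁ β₂)^[j] (x, y)).2 : ℝ) < β₂ / 2 := fun j => mem_iInter.1 hmem j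
      have hfst : 1 - (1 / 2) ^ N < (((skew β₁ β₂)^[n] (x, y)).1 : ℝ) := by
        rw [iterate_skew_fst, iterate_base_eq_of_mem_Ioc (k := k) ⟨by linarith, hxv.le⟩]
        linarith
      have hgrow := pow_mul_snd_le_of_forall_le hfst (fun j => by
        rw [← Function.iterate_add_apply]
        exact (hstay _).le) le_rfl
      rw [← Function.iterate_add_apply] at hgrow
      have hlow := pow_mul_snd_le_coe_iterate_skew_snd β₁ β₂ (x, y) n
      have hlow' : c ^ n * (r / 2) ≤ (((skew β₁ β₂)^[n] (x, y)).2 : ℝ) :=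
        (mul_le_mul_of_nonneg_left hsy.le (by positivity)).trans hlow
      have := mul_le_mul_of_nonneg_left hlow'
        (show 0 ≤ (1 + (β₂ : ℝ) / 4) ^ N by positivity)
      linarith [hstay (N + n)]

/-! ### Transfer along a conjugacy -/

section Conjugacy

variable {M : Type*}

theorem preimage_basin_of_semiconj [TopologicalSpace M] {F G : M → M} (e : M ≃ₜ M)
    (h : Function.Semiconj e F G) (A : Set M) : e ⁻¹' basin G A = basin F (e ⁻¹' A) := by
  ext p
  have hiter : (fun n : ℕ => G^[n] (e p)) = e ∘ fun n : ℕ => F^[n] p :=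
    funext fun n => ((h.iterate_right n) p).symm
  simp only [basin, mem_preimage, mem_ofPred_eq, subset_def,
    mem_omegaLimit_singleton_iff_mapClusterPt, hiter]
  constructor
  · exact fun H z hz => H _ (hz.continuousAt_comp e.continuous.continuousAt)
  · intro H w hw
    have hw' := hw.continuousAt_comp e.symm.continuous.continuousAt
    rw [← Function.comp_assoc, e.symm_comp_self, Function.id_comp] at hw'
    simpa using H _ hw'

theorem IsMilnorAttractor.preimage_of_semiconj [TopologicalSpace M] [MeasureSpace M]
    [BorelSpace M] {F G : M → M} (e : M ≃ₜ M) (h : Function.Semiconj e F G)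
    (he : MeasurePreserving e) (he' : MeasurePreserving e.symm) {A : Set M}
    (hA : IsMilnorAttractor G A) : IsMilnorAttractor F (e ⁻¹' A) where
  isCompact := e.isCompact_preimage.2 hA.isCompact
  image_eq := by
    have : e '' (F '' (e ⁻¹' A)) = A := by
      rw [h.set_image.eq, image_preimage_eq _ e.surjective, hA.image_eq]
    rw [← preimage_image_eq (F '' _) e.injective, this]
  basin_pos := by
    rw [← preimage_basin_of_semiconj e h,
      he.measure_preimage_emb e.measurableEmbedding]
    exact hA.basin_pos
  minimal := by
    rintro ⟨A', hA', hc, hae⟩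
    refine hA.minimal ⟨e.symm ⁻¹' A', ?_, e.symm.isCompact_preimage.2 hc, ?_⟩
    · rw [← e.image_eq_preimage_symm]
      refine ⟨image_subset_iff.2 hA'.1, fun hs => hA'.2 fun x hx => ?_⟩
      obtain ⟨y, hy, hyx⟩ := hs hx
      rwa [← e.injective hyx]
    · have hA'' : e ⁻¹' (e.symm ⁻¹' A') = A' := by
        ext x; simp
      rw [← hA'', ← preimage_basin_of_semiconj e h, ← preimage_basin_of_semiconj e h] at hae
      have := he'.quasiMeasurePreserving.preimage_ae_eq hae
      simpa only [← preimage_comp, e.self_comp_symm, preimage_id] using this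

theorem HasLocallyRiddledBasin.preimage_of_semiconj [PseudoMetricSpace M] [MeasureSpace M]
    [BorelSpace M] {F G : M → M} (e : M ≃ₜ M) (h : Function.Semiconj e F G)
    (he : MeasurePreserving e) (he' : MeasurePreserving e.symm) (hiso : Isometry e) {A : Set M}
    (hA : HasLocallyRiddledBasin G A) : HasLocallyRiddledBasin F (e ⁻¹' A) where
  isMilnorAttractor := hA.isMilnorAttractor.preimage_of_semiconj e h he he'
  riddled := by
    obtain ⟨U, hU, hAU, H⟩ := hA.riddled
    refine ⟨e ⁻¹' U, hU.preimage e.continuous, preimage_mono hAU, fun p hp ε hε => ?_⟩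
    have hset : Metric.ball p ε ∩ (⋂ n : ℕ, F^[n] ⁻¹' (e ⁻¹' U))ᶜ =
        e ⁻¹' (Metric.ball (e p) ε ∩ (⋂ n : ℕ, G^[n] ⁻¹' U)ᶜ) := by
      rw [preimage_inter, hiso.preimage_ball, preimage_compl, preimage_iInter]
      congr! 4 with n
      rw [← preimage_comp, ← preimage_comp, (h.iterate_right n).comp_eq]
    rw [hset, he.measure_preimage_emb e.measurableEmbedding]
    exact H _ hp ε hε

end Conjugacy

/-- The reflection `(x, y) ↦ (x, 1 - y)` of the unit square. -/
def reflect : unitInterval × unitInterval ≃ₜ unitInterval × unitInterval :=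
  (Homeomorph.refl _).prodCongr unitInterval.symmHomeomorph

/-- Reflection changes the sign of `y - β` and preserves `y * (1 - y)`, so the two branches are not
exchanged. -/
theorem reflect_semiconj (β₁ β₂ : unitInterval) :
    Function.Semiconj reflect (skew β₁ β₂)
      (skew (unitInterval.symm β₁) (unitInterval.symm β₂)) := by
  intro p
  refine Prod.ext rfl (Subtype.ext ?_)
  rw [coe_skew_snd]
  change 1 - ((skew β₁ β₂ p).2 : ℝ) = if (p.1 : ℝ) ≤ 1 / 2 then
    (1 - p.2 : ℝ) + (1 - p.2) * (1 - (1 - p.2)) * ((1 - p.2) - (1 - β₁))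
    else (1 - p.2 : ℝ) - (1 - p.2) * (1 - (1 - p.2)) * ((1 - p.2) - (1 - β₂))
  rw [coe_skew_snd]
  split_ifs <;> ring

theorem measurePreserving_reflect : MeasurePreserving reflect :=
  (MeasurePreserving.id volume).prod unitInterval.measurePreserving_symm

theorem isometry_reflect : Isometry reflect := by
  refine Isometry.of_dist_eq fun p q => ?_
  rw [Prod.dist_eq, Prod.dist_eq]
  congr 1
  change |(1 - (p.2 : ℝ)) - (1 - q.2)| = |(p.2 : ℝ) - q.2|
  rw [abs_sub_comm]
  congr 1
  ring

theorem reflect_preimage_attractorZero : reflect ⁻¹' attractorZero = attractorOne := by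
  ext p
  change (True ∧ unitInterval.symm p.2 = 0) ↔ (True ∧ p.2 = 1)
  rw [unitInterval.symm_eq_zero]

/-! ### The parameter region. -/

/-- With denominators cleared, the last two conditions say that the normal exponents of
`attractorOne` and `attractorZero` are negative, in that order. -/
theorem mem_gammaS_iff {b : ℝ × ℝ} : b ∈ gammaS ↔ b.1 ∈ Ioo (0 : ℝ) 1 ∧ b.2 ∈ Ioo (0 : ℝ) 1 ∧
    b.1 * (2 - b.2) < 1 ∧ (1 - b.1) * (1 + b.2) < 1 := by
  refine and_congr_right fun h1 => and_congr_right fun _ => and_congr ?_ ?_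
  · rw [sub_lt_comm, lt_div_iff₀' h1.1]
  · rw [lt_sub_iff_add_lt, lt_div_iff₀' (sub_pos.2 h1.2), add_comm]

theorem isOpen_gammaS : IsOpen gammaS := by
  have : gammaS = Prod.fst ⁻¹' Ioo (0 : ℝ) 1 ∩ (Prod.snd ⁻¹' Ioo (0 : ℝ) 1 ∩
      ({b : ℝ × ℝ | b.1 * (2 - b.2) < 1} ∩ {b : ℝ × ℝ | (1 - b.1) * (1 + b.2) < 1})) :=
    Set.ext fun _ => mem_gammaS_iff
  rw [this]
  exact (isOpen_Ioo.preimage continuous_fst).inter ((isOpen_Ioo.preimage continuous_snd).inter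
    ((isOpen_lt (by fun_prop) continuous_const).inter (isOpen_lt (by fun_prop) continuous_const)))

theorem gammaS_nonempty : gammaS.Nonempty :=
  ⟨(1 / 2, 1 / 2), by rw [mem_gammaS_iff]; norm_num⟩

end RiddledSkew

end

theorem corollary3p4 :
    IsOpen RiddledSkew.gammaS ∧ RiddledSkew.gammaS.Nonempty ∧
    ∀ β₁ β₂ : unitInterval, ((β₁ : ℝ), (β₂ : ℝ)) ∈ RiddledSkew.gammaS →
      (RiddledSkew.IsMilnorAttractor (RiddledSkew.skew β₁ β₂) RiddledSkew.attractorZero ∧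
        RiddledSkew.HasLocallyRiddledBasin (RiddledSkew.skew β₁ β₂) RiddledSkew.attractorZero) ∧
      (RiddledSkew.IsMilnorAttractor (RiddledSkew.skew β₁ β₂) RiddledSkew.attractorOne ∧
        RiddledSkew.HasLocallyRiddledBasin (RiddledSkew.skew β₁ β₂) RiddledSkew.attractorOne) := by
  refine ⟨RiddledSkew.isOpen_gammaS, RiddledSkew.gammaS_nonempty, fun β₁ β₂ h => ?_⟩
  obtain ⟨⟨h10, h11⟩, ⟨h20, h21⟩, hone, hzero⟩ := RiddledSkew.mem_gammaS_iff.1 h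
  have hA₀ := RiddledSkew.hasLocallyRiddledBasin_attractorZero h11 h20 hzero
  have hA₁ : RiddledSkew.HasLocallyRiddledBasin (RiddledSkew.skew β₁ β₂)
      RiddledSkew.attractorOne := by
    rw [← RiddledSkew.reflect_preimage_attractorZero]
    refine RiddledSkew.HasLocallyRiddledBasin.preimage_of_semiconj RiddledSkew.reflect
      (RiddledSkew.reflect_semiconj β₁ β₂) RiddledSkew.measurePreserving_reflect
      RiddledSkew.measurePreserving_reflect RiddledSkew.isometry_reflect
      (RiddledSkew.hasLocallyRiddledBasin_attractorZero ?_ ?_ ?_)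
    · rw [unitInterval.coe_symm_eq]
      exact sub_lt_self 1 h10
    · rw [unitInterval.coe_symm_eq]
      exact sub_pos.2 h21
    · rw [unitInterval.coe_symm_eq, unitInterval.coe_symm_eq]
      calc (1 - (1 - (β₁ : ℝ))) * (1 + (1 - β₂)) = β₁ * (2 - β₂) := by ring
        _ < 1 := hone
  exact ⟨⟨hA₀.isMilnorAttractor, hA₀⟩, ⟨hA₁.isMilnorAttractor, hA₁⟩⟩
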